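/- Let $q$ be a prime power that is a square, and identify the points of $PG(2,q)$ with the classes of $\mathbb F_{q^3}^*$ modulo $\mathbb F_q^*$. Let $\alpha$ be a primitive element of $\mathbb F_{q^3}$, let $P_i$ be the point represented by $\alpha^i$, and let $\sigma$ be the Singer cycle $P_i\mapsto P_{i+1}$ (multiplication by $\alpha$), of order $q^2+q+1$. Put $d=q-\sqrt q+1$ and $t=(q^2+q+1)/d$, and let $\widehat S_d=\langle\sigma^t\rangle$ be the Singer subgroup of order $d$. For $0\le u\le t-1$ let $O_u$ be the orbit of $P_u$ under $\widehat S_d$. Fix an arbitrary line $\ell_0$ of $PG(2,q)$ and put $w_u=|\ell_0\cap O_u|$. Then $d$ divides $q^2+q+1$, $t=q+\sqrt q+1$, and $w_u\le 2$ for every $u\in\{0,\dots,t-1\}$. Exactly $\frac12(q+\sqrt q)$ of the numbers $w_0,\dots,w_{t-1}$ are equal to $0$, exactly $\sqrt q+1$ are equal to $1$, and exactly $\frac12(q-\sqrt q)$ are equal to $2$. Moreover, every orbit $O_u$ consists of $d$ points and is a Kestenband–Ebert arc, that is, a set of points no three of which are collinear that is an orbit of a subgroup of order $q-\sqrt q+1$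 of a Singer group; and if $q>4$, then every $O_u$ is a complete arc (it is not properly contained in another arc). -/

import Mathlib

open scoped LinearAlgebra.Projectivization

namespace SingerOrbits

/-- The lines of the projective space of `E` over `F`, as sets of points: the points contained in a
two-dimensional linear subspace of `E`. -/
def IsLine (F : Type*) {E : Type*} [Field F] [AddCommGroup E] [Module F E]
    (ℓ : Set (ℙ F E)) : Prop :=
  ∃ W : Submodule F E, Module.finrank F W = 2 ∧ ℓ = {P : ℙ F E | P.submodule ≤ W}

/-- An arc: a set of points no three of which are collinear. -/
def IsArc (F : Type*) {E : Type*} [Field F] [AddCommGroup E] [Module F E]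
    (K : Set (ℙ F E)) : Prop :=
  ∀ P ∈ K, ∀ Q ∈ K, ∀ R ∈ K, P ≠ Q → P ≠ R → Q ≠ R →
    ¬ ∃ ℓ : Set (ℙ F E), IsLine F ℓ ∧ P ∈ ℓ ∧ Q ∈ ℓ ∧ R ∈ ℓ

/-- A complete arc: an arc that is not properly contained in another arc. -/
def IsCompleteArc (F : Type*) {E : Type*} [Field F] [AddCommGroup E] [Module F E]
    (K : Set (ℙ F E)) : Prop :=
  Maximal (IsArc F) K

variable (F : Type*) {E : Type*} [Field F] [Field E] [Algebra F E]

/-- `α` is a primitive element of `E`: a generator of the multiplicative group of `E`. -/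
def IsPrimitive {E : Type*} [Field E] (α : Eˣ) : Prop :=
  ∀ x : Eˣ, x ∈ Subgroup.zpowers α

/-- The point `P_i` represented by `α ^ i`. -/
def point (α : Eˣ) (i : ℕ) : ℙ F E :=
  Projectivization.mk F ((α ^ i : Eˣ) : E) (Units.ne_zero _)

/-- The permutation `σ` of the points induced by multiplication by `α`. -/
def sigma (α : Eˣ) : Equiv.Perm (ℙ F E) :=
  MulAction.toPerm α

/-- `σ` maps `P_i` to `P_{i+1}`. -/
theorem sigma_point (α : Eˣ) (i : ℕ) : sigma F α (point F α i) = point F α (i + 1) := by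
  simp only [sigma, point, MulAction.toPerm_apply, Projectivization.smul_mk]
  congr 1
  rw [pow_succ', Units.val_mul, Units.smul_def, smul_eq_mul]

/-- The Singer group: the cyclic group generated by `σ`. -/
def singerGroup (α : Eˣ) : Subgroup (Equiv.Perm (ℙ F E)) :=
  Subgroup.zpowers (sigma F α)

/-- The number `t = v / d`, where `v = q² + q + 1` and `q = |F|`
(used for divisors `d` of `v` only). -/
noncomputable def singerIndex (d : ℕ) : ℕ :=
  (Nat.card F ^ 2 + Nat.card F + 1) / d

/-- The Singer subgroup of order `d`, generated by `σ ^ t` with `t = v / d`. -/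
noncomputable def singerSubgroup (α : Eˣ) (d : ℕ) : Subgroup (Equiv.Perm (ℙ F E)) :=
  Subgroup.zpowers (sigma F α ^ singerIndex F d)

/-- The orbit `O_u` of the point `P_u` under the Singer subgroup of order `d`. -/
noncomputable def singerOrbit (α : Eˣ) (d u : ℕ) : Set (ℙ F E) :=
  MulAction.orbit (singerSubgroup F α d) (point F α u)

/-- The intersection number `w_u = |ℓ₀ ∩ O_u|`. -/
noncomputable def w (α : Eˣ) (d : ℕ) (ℓ₀ : Set (ℙ F E)) (u : ℕ) : ℕ :=
  (ℓ₀ ∩ singerOrbit F α d u).ncard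

/-- A Kestenband–Ebert arc of `PG(2, q)`, `q` a square: an arc that is a point orbit of a subgroup
of order `q - √q + 1` of a Singer group. -/
def IsKestenbandEbertArc (K : Set (ℙ F E)) : Prop :=
  IsArc F K ∧
    ∃ (α : Eˣ) (H : Subgroup (Equiv.Perm (ℙ F E))) (P : ℙ F E) (s : ℕ),
      IsPrimitive α ∧ H ≤ singerGroup F α ∧ Nat.card F = s ^ 2 ∧
        Nat.card H = Nat.card F - s + 1 ∧ K = MulAction.orbit H P

end SingerOrbits

namespace SingerOrbits

/-! ### Field theory of `F_q` inside `F_{q^3}`, and the algebraic core of the arc property -/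

section Field

variable {F E : Type*} [Field F] [Finite F] [Field E] [Algebra F E] {s : ℕ}

/-! Write `q = s ^ 2` and `M = (s - 1) * (s ^ 3 + 1) = (q - 1) * d`. The vectors representing the
points of one orbit form a coset of the subgroup `C` of order `M` of the multiplicative group of
`E`, that is, a fibre of `x ↦ x ^ M` (`singerOrbit_eq`). As `F^*` lies in `C`, these fibres are
unions of punctured lines through the origin, and everything can be computed in `E`.

Arcs: `x ^ (s ^ 3 + 1)` is the norm of `x` to the subfield of order `s ^ 3`, and `x` lies in `C` iff
this norm lies in the field with `s` elements. If `r` and `r + 1` are in `C`, expanding the norm of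
`r + 1` puts the trace of `r` there too. So `r` is a root of a quadratic over that field and hence
lies in `F` (`exists_algebraMap_mul_eq_of_pow_eq`). Three collinear points of an orbit would give
such an `r` outside `F`.

Intersection numbers: all `w_u` are at most 2, so their first two moments determine the counts `n₀,
n₁, n₂`. The sum is `q + 1`. For the second moment, count pairs `x, g * x` in the plane `W` of the
line with `g` in `C`: a scalar `g` preserves `W`, and for any other `g` the planes `W` and `g⁻¹ W`
meet in dimension one. This gives `q + 1 + (q - s)`.

Completeness: a point outside the orbit must lie on a secant, that is, every nonzero `p` outside `C`
is a sum of two elements of `C`. For `s ≥ 4` this follows by counting lines through a point of the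
arc. The count fails for `s = 3`, where the sum is found by solving a quadratic over the field of
order 27. -/

theorem two_le_of_card_eq_sq (hs : Nat.card F = s ^ 2) : 2 ≤ s := by
  have h : 1 < Nat.card F := Finite.one_lt_card
  rw [hs] at h
  by_contra! hlt
  interval_cases s <;> omega

omit [Finite F] in
theorem card_eq_pow_six (hE : Module.finrank F E = 3) (hs : Nat.card F = s ^ 2) :
    Nat.card E = s ^ 6 := by
  have : FiniteDimensional F E := Module.finite_of_finrank_pos (by omega)
  rw [Module.natCard_eq_pow_finrank (K := F), hE, hs]
  ring

/-- Since `s ^ 2` is a power of the characteristic, so is `s`, and `x ↦ x ^ s` is a Frobenius power.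
-/
theorem add_pow_of_card_eq_sq (hs : Nat.card F = s ^ 2) (x y : E) :
    (x + y) ^ s = x ^ s + y ^ s := by
  have : Fintype F := Fintype.ofFinite F
  obtain ⟨p, hp⟩ := CharP.exists F
  obtain ⟨n, hprime, hn⟩ := FiniteField.card F p
  rw [← Nat.card_eq_fintype_card, hs] at hn
  have hdvd : s ∣ p ^ (n : ℕ) := hn ▸ Dvd.intro_left (s ^ 1) (by ring)
  obtain ⟨k, -, rfl⟩ := (Nat.dvd_prime_pow hprime).1 hdvd
  have : Fact p.Prime := ⟨hprime⟩
  have : CharP E p := charP_of_injective_algebraMap (algebraMap F E).injective p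
  exact add_pow_char_pow x y p k

theorem pow_six_eq_self (hE : Module.finrank F E = 3) (hs : Nat.card F = s ^ 2) (x : E) :
    x ^ s ^ 6 = x := by
  have : FiniteDimensional F E := Module.finite_of_finrank_pos (by omega)
  have : Finite E := Module.finite_of_finite F
  have : Fintype E := Fintype.ofFinite E
  rw [← card_eq_pow_six hE hs, Nat.card_eq_fintype_card, FiniteField.pow_card]

theorem algebraMap_pow_sq (hs : Nat.card F = s ^ 2) (c : F) :
    algebraMap F E c ^ s ^ 2 = algebraMap F E c := by
  have : Fintype F := Fintype.ofFinite F
  rw [← map_pow, ← hs, Nat.card_eq_fintype_card, FiniteField.pow_card]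

/-- The image of `F` already supplies all `s ^ 2` possible roots of `X ^ s ^ 2 - X`. -/
theorem exists_algebraMap_eq_of_pow_sq (hs : Nat.card F = s ^ 2) {x : E} (hx : x ^ s ^ 2 = x) :
    ∃ c : F, algebraMap F E c = x := by
  classical
  have : Fintype F := Fintype.ofFinite F
  have h2 := two_le_of_card_eq_sq hs
  have h1 : 1 < s ^ 2 := by nlinarith
  let p : Polynomial E := Polynomial.X ^ s ^ 2 - Polynomial.X
  have hp : p ≠ 0 := FiniteField.X_pow_card_sub_X_ne_zero E h1
  have hsub : Finset.univ.map ⟨algebraMap F E, (algebraMap F E).injective⟩ ⊆ p.roots.toFinset := by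
    intro y hy
    obtain ⟨c, -, rfl⟩ := Finset.mem_map.1 hy
    simp [p, hp, Polynomial.IsRoot, algebraMap_pow_sq hs]
  have hcard : p.roots.toFinset.card ≤
      (Finset.univ.map ⟨algebraMap F E, (algebraMap F E).injective⟩).card := by
    rw [Finset.card_map, Finset.card_univ, ← Nat.card_eq_fintype_card, hs]
    calc _ ≤ _ := Multiset.toFinset_card_le _
      _ ≤ p.natDegree := Polynomial.card_roots' p
      _ = s ^ 2 := FiniteField.X_pow_card_sub_X_natDegree_eq E h1
  have hmem : x ∈ p.roots.toFinset := by
    simp [p, hp, Polynomial.IsRoot, hx]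
  rw [← Finset.eq_of_subset_of_card_le hsub hcard] at hmem
  obtain ⟨c, -, hc⟩ := Finset.mem_map.1 hmem
  exact ⟨c, hc⟩

theorem exp_eq_mul (h2 : 2 ≤ s) :
    (s - 1) * (s ^ 3 + 1) = (s ^ 2 - 1) * (s ^ 2 - s + 1) := by
  obtain ⟨r, rfl⟩ : ∃ r, s = r + 1 := ⟨s - 1, by omega⟩
  have e1 : (r + 1) ^ 2 - 1 = r ^ 2 + 2 * r := by rw [Nat.sub_eq_iff_eq_add (by nlinarith)]; ring
  have e2 : (r + 1) ^ 2 - (r + 1) = r ^ 2 + r := by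
    rw [Nat.sub_eq_iff_eq_add (by nlinarith)]; ring
  rw [e1, e2, Nat.add_sub_cancel]; ring

theorem algebraMap_pow_eq_one (hs : Nat.card F = s ^ 2) {c : F} (hc : c ≠ 0) :
    algebraMap F E c ^ ((s - 1) * (s ^ 3 + 1)) = 1 := by
  have h2 := two_le_of_card_eq_sq hs
  have hc' : algebraMap F E c ≠ 0 := by simpa using hc
  have h : algebraMap F E c ^ (s ^ 2 - 1) = 1 := by
    have := algebraMap_pow_sq (E := E) hs c
    rw [← pow_sub_one_mul (by positivity)] at this
    exact mul_eq_right₀ hc' |>.1 this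
  rw [exp_eq_mul h2, pow_mul, h, one_pow]

theorem pow_eq_one_iff_norm_pow (h2 : 2 ≤ s) {x : E} (hx : x ≠ 0) :
    x ^ ((s - 1) * (s ^ 3 + 1)) = 1 ↔ (x ^ (s ^ 3 + 1)) ^ s = x ^ (s ^ 3 + 1) := by
  rw [mul_comm, pow_mul]
  set y := x ^ (s ^ 3 + 1)
  have hy : y ≠ 0 := pow_ne_zero _ hx
  obtain ⟨r, rfl⟩ : ∃ r, s = r + 1 := ⟨s - 1, by omega⟩
  rw [Nat.add_sub_cancel, pow_succ y r, mul_eq_right₀ hy]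

theorem pow_pow_three_add (hs : Nat.card F = s ^ 2) (x y : E) :
    (x + y) ^ s ^ 3 = x ^ s ^ 3 + y ^ s ^ 3 := by
  rw [show s ^ 3 = s * s * s by ring]
  simp only [pow_mul, add_pow_of_card_eq_sq hs]

/-- Two elements that together with their sum have the same `(s - 1) * (s ^ 3 + 1)`-th power
are proportional over the field with `s ^ 2` elements. -/
theorem exists_algebraMap_mul_eq_of_pow_eq (hE : Module.finrank F E = 3)
    (hs : Nat.card F = s ^ 2) {x y : E} (hx : x ≠ 0) (hy : y ≠ 0) (hxy : x + y ≠ 0)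
    (h₁ : x ^ ((s - 1) * (s ^ 3 + 1)) = y ^ ((s - 1) * (s ^ 3 + 1)))
    (h₂ : (x + y) ^ ((s - 1) * (s ^ 3 + 1)) = y ^ ((s - 1) * (s ^ 3 + 1))) :
    ∃ c : F, x = algebraMap F E c * y := by
  have hs2 := two_le_of_card_eq_sq hs
  set r := x / y with hr
  have hr0 : r ≠ 0 := div_ne_zero hx hy
  have hr1e : r + 1 = (x + y) / y := by rw [hr]; field_simp
  have hr1 : r + 1 ≠ 0 := hr1e ▸ div_ne_zero hxy hy
  have hyM := pow_ne_zero ((s - 1) * (s ^ 3 + 1)) hy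
  have a₁ : r ^ ((s - 1) * (s ^ 3 + 1)) = 1 := by rw [hr, div_pow, h₁, div_self hyM]
  have a₂ : (r + 1) ^ ((s - 1) * (s ^ 3 + 1)) = 1 := by rw [hr1e, div_pow, h₂, div_self hyM]
  rw [pow_eq_one_iff_norm_pow hs2 hr0] at a₁
  rw [pow_eq_one_iff_norm_pow hs2 hr1] at a₂
  set r' := r ^ s ^ 3 with hr'
  have n₁ : r ^ (s ^ 3 + 1) = r' * r := pow_succ _ _
  have n₂ : (r + 1) ^ (s ^ 3 + 1) = r' * r + (r' + r) + 1 := by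
    rw [pow_succ, pow_pow_three_add hs, one_pow]; ring
  rw [n₁] at a₁
  rw [n₂, add_pow_of_card_eq_sq hs, add_pow_of_card_eq_sq hs, a₁, one_pow] at a₂
  have a₃ : (r' + r) ^ s = r' + r := by
    exact add_left_cancel (add_right_cancel a₂)
  -- `r' * r` and `r' + r` are the norm and trace of `r`; both are fixed by the `s`-power map, so `r
  -- ^ s` is again a root of `(X - r) * (X - r')`.
  have hroot : (r ^ s - r) * (r ^ s - r') = 0 := by
    rw [mul_pow] at a₁
    rw [add_pow_of_card_eq_sq hs] at a₃
    linear_combination r ^ s * a₃ - a₁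
  have key : r ^ s ^ 2 = r := by
    rcases mul_eq_zero.1 hroot with h | h
    · rw [sub_eq_zero] at h
      rw [sq, pow_mul, h, h]
    · rw [sub_eq_zero, hr'] at h
      -- Raising to the power `s ^ 5` undoes the `s`-power map, because `x ^ s ^ 6 = x` on `E`.
      have : (r ^ s) ^ s ^ 5 = (r ^ s ^ 3) ^ s ^ 5 := by rw [h]
      rw [← pow_mul, ← pow_mul, show s * s ^ 5 = s ^ 6 by ring,
        show s ^ 3 * s ^ 5 = s ^ 6 * s ^ 2 by ring, pow_mul r (s ^ 6),
        pow_six_eq_self hE hs] at this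
      exact this.symm
  obtain ⟨c, hc⟩ := exists_algebraMap_eq_of_pow_sq hs key
  exact ⟨c, by rw [hc, hr, div_mul_cancel₀ _ hy]⟩

end Field

/-! ### Fibres of the `M`-th power map; each fibre is an arc -/

section Field

variable {F E : Type*} [Field F] [Finite F] [Field E] [Algebra F E] {s : ℕ}

theorem pow_six_sub_one_eq (h2 : 2 ≤ s) :
    s ^ 6 - 1 = (s ^ 2 + s + 1) * ((s - 1) * (s ^ 3 + 1)) := by
  obtain ⟨r, rfl⟩ : ∃ r, s = r + 1 := ⟨s - 1, by omega⟩
  rw [Nat.sub_eq_iff_eq_add (Nat.pow_pos (by omega)), Nat.add_sub_cancel]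
  ring

theorem IsPrimitive.isPrimitiveRoot {α : Eˣ} (hα : IsPrimitive α)
    (hE : Module.finrank F E = 3) (hs : Nat.card F = s ^ 2) :
    IsPrimitiveRoot (α : E) (s ^ 6 - 1) := by
  have : FiniteDimensional F E := Module.finite_of_finrank_pos (by omega)
  have : Finite E := Module.finite_of_finite F
  have h : IsPrimitiveRoot α (orderOf α) := IsPrimitiveRoot.orderOf α
  rw [orderOf_eq_card_of_forall_mem_zpowers hα, Nat.card_units, card_eq_pow_six hE hs] at h
  exact IsPrimitiveRoot.coe_units_iff.2 h

theorem exp_pos_of_two_le (h2 : 2 ≤ s) : 0 < (s - 1) * (s ^ 3 + 1) :=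
  Nat.mul_pos (by omega) (by omega)

/-- Each fibre is a translate of the group of `M`-th roots of unity, which is generated by `α ^ (s ^
2 + s + 1)`. -/
theorem card_filter_pow_eq [Fintype E] [DecidableEq E] {α : Eˣ} (hα : IsPrimitive α)
    (hE : Module.finrank F E = 3) (hs : Nat.card F = s ^ 2) {a : E} (ha : a ≠ 0) :
    (Finset.univ.filter fun x : E ↦
      x ^ ((s - 1) * (s ^ 3 + 1)) = a ^ ((s - 1) * (s ^ 3 + 1))).card =
      (s - 1) * (s ^ 3 + 1) := by
  have h2 := two_le_of_card_eq_sq hs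
  have hM := exp_pos_of_two_le h2
  set M := (s - 1) * (s ^ 3 + 1) with hMdef
  have hroot : IsPrimitiveRoot ((α : E) ^ (s ^ 2 + s + 1)) M := by
    refine (hα.isPrimitiveRoot hE hs).pow ?_ (pow_six_sub_one_eq h2)
    have := Nat.one_lt_pow (n := 6) (by omega) (show 1 < s by omega)
    omega
  have himage : (Finset.univ.filter fun x : E ↦ x ^ M = a ^ M) =
      (Polynomial.nthRootsFinset M (1 : E)).image (fun x ↦ a * x) := by
    ext x
    simp only [Finset.mem_filter, Finset.mem_univ, true_and, Finset.mem_image,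
      Polynomial.mem_nthRootsFinset hM]
    constructor
    · intro h
      exact ⟨x / a, by rw [div_pow, h, div_self (pow_ne_zero _ ha)], mul_div_cancel₀ _ ha⟩
    · rintro ⟨y, hy, rfl⟩
      rw [mul_pow, hy, mul_one]
  rw [himage, Finset.card_image_of_injective _ (mul_right_injective₀ ha),
    hroot.card_nthRootsFinset]

theorem smul_pow_eq (hs : Nat.card F = s ^ 2) {c : F} (hc : c ≠ 0) (x : E) :
    (c • x) ^ ((s - 1) * (s ^ 3 + 1)) = x ^ ((s - 1) * (s ^ 3 + 1)) := by
  rw [Algebra.smul_def, mul_pow, algebraMap_pow_eq_one hs hc, one_mul]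

omit [Finite F] in
theorem eq_of_rep_eq_smul {P Q : ℙ F E} {c : F} (h : P.rep = c • Q.rep) : P = Q := by
  rw [← P.mk_rep, ← Q.mk_rep]
  exact (Projectivization.mk_eq_mk_iff' _ _ _ _ _).2 ⟨c, h.symm⟩

/-- A third point on the line is a combination of the first two with both coefficients nonzero.
Scalars do not change the `M`-th power, so the coefficients can be absorbed, leaving two vectors and
their sum in one fibre. -/
theorem isArc_setOf_rep_pow_eq (hE : Module.finrank F E = 3) (hs : Nat.card F = s ^ 2) (k : E) :
    IsArc F {P : ℙ F E | P.rep ^ ((s - 1) * (s ^ 3 + 1)) = k} := by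
  have : FiniteDimensional F E := Module.finite_of_finrank_pos (by omega)
  rintro P hP Q hQ R hR hPQ hPR hQR ⟨_, ⟨W, hW, rfl⟩, hPW, hQW, hRW⟩
  simp only [Set.mem_ofPred_eq, Projectivization.submodule_eq,
    Submodule.span_singleton_le_iff_mem] at hP hQ hR hPW hQW hRW
  have hli : LinearIndependent F ![P.rep, Q.rep] :=
    Projectivization.linearIndependent_pair_iff_ne.2 hPQ
  have hle : Submodule.span F {P.rep, Q.rep} ≤ W :=
    Submodule.span_le.2 (by rintro x (rfl | rfl) <;> assumption)
  have hspan : Submodule.span F {P.rep, Q.rep} = W := by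
    refine Submodule.eq_of_le_of_finrank_eq hle ?_
    have := finrank_span_eq_card hli
    rw [Matrix.range_cons, Matrix.range_cons, Matrix.range_empty, Set.union_empty,
      Set.singleton_union, Fintype.card_fin] at this
    rw [this, hW]
  rw [← hspan, Submodule.mem_span_pair] at hRW
  obtain ⟨a, b, hab⟩ := hRW
  have ha : a ≠ 0 := by
    rintro rfl
    exact hQR (eq_of_rep_eq_smul (c := b) (by rw [← hab]; simp)).symm
  have hb : b ≠ 0 := by
    rintro rfl
    exact hPR (eq_of_rep_eq_smul (c := a) (by rw [← hab]; simp)).symm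
  obtain ⟨c, hc⟩ := exists_algebraMap_mul_eq_of_pow_eq hE hs
    (smul_ne_zero ha P.rep_nonzero) (smul_ne_zero hb Q.rep_nonzero) (hab ▸ R.rep_nonzero)
    (by rw [smul_pow_eq hs ha, smul_pow_eq hs hb, hP, hQ])
    (by rw [hab, smul_pow_eq hs hb, hR, hQ])
  refine hPQ (eq_of_rep_eq_smul (c := a⁻¹ * (c * b)) ?_)
  rw [← Algebra.smul_def] at hc
  rw [mul_smul, mul_smul, ← hc, inv_smul_smul₀ ha]

/-! ### Completeness for `s ≥ 4`: counting lines through the point 1 -/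

theorem mem_range_of_pow_eq_of_add (hE : Module.finrank F E = 3) (hs : Nat.card F = s ^ 2)
    {y : E} {e : F} (hy : y ≠ 0) (he : e ≠ 0) (hye : y + algebraMap F E e ≠ 0)
    (h₁ : y ^ ((s - 1) * (s ^ 3 + 1)) = 1)
    (h₂ : (y + algebraMap F E e) ^ ((s - 1) * (s ^ 3 + 1)) = 1) :
    ∃ c : F, y = algebraMap F E c := by
  have h := algebraMap_pow_eq_one (E := E) hs he
  obtain ⟨c, hc⟩ := exists_algebraMap_mul_eq_of_pow_eq hE hs hy
    (by simpa using he) hye (h₁.trans h.symm) (h₂.trans h.symm)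
  exact ⟨c * e, by rw [hc, map_mul]⟩

/-- The vectors `y`, `y + e`, `y + f` lie in one plane and satisfy `e (y + f) + (f - e) y = f (y +
e)`, so the arc property makes the first and third proportional. -/
theorem mem_range_of_pow_eq_of_add_of_add (hE : Module.finrank F E = 3)
    (hs : Nat.card F = s ^ 2) {y : E} {e f : F} (hy : y ≠ 0) (he : e ≠ 0) (hf : f ≠ 0)
    (hef : e ≠ f) (hye : y + algebraMap F E e ≠ 0) (hyf : y + algebraMap F E f ≠ 0)
    (h₁ : (y + algebraMap F E e) ^ ((s - 1) * (s ^ 3 + 1)) = y ^ ((s - 1) * (s ^ 3 + 1)))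
    (h₂ : (y + algebraMap F E f) ^ ((s - 1) * (s ^ 3 + 1)) = y ^ ((s - 1) * (s ^ 3 + 1))) :
    ∃ c : F, y = algebraMap F E c := by
  have hfe : f - e ≠ 0 := sub_ne_zero.2 hef.symm
  have hsum : e • (y + algebraMap F E f) + (f - e) • y = f • (y + algebraMap F E e) := by
    simp only [Algebra.smul_def, map_sub]; ring
  obtain ⟨c, hc⟩ := exists_algebraMap_mul_eq_of_pow_eq hE hs
    (smul_ne_zero he hyf) (smul_ne_zero hfe hy) (hsum ▸ smul_ne_zero hf hye)
    (by rw [smul_pow_eq hs he, smul_pow_eq hs hfe, h₂])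
    (by rw [hsum, smul_pow_eq hs hf, smul_pow_eq hs hfe, h₁])
  simp only [Algebra.smul_def, map_sub] at hc
  have hef0 : algebraMap F E e * algebraMap F E f ≠ 0 := by
    rw [← map_mul]; simpa using ⟨he, hf⟩
  set k : F := c * (f - e) - e with hk
  have hky : algebraMap F E k * y = algebraMap F E e * algebraMap F E f := by
    simp only [hk, map_sub, map_mul]; linear_combination -hc
  have hk0 : k ≠ 0 := by
    rintro h; rw [h, map_zero, zero_mul] at hky; exact hef0 hky.symm
  refine ⟨e * f / k, ?_⟩
  have : algebraMap F E k ≠ 0 := by simpa using hk0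
  rw [map_div₀, map_mul, ← hky]; field_simp

/-- Cosets of `F` in `E` other than `F` describe the `q + 1` lines through the point 1. Of these, `d
- 1` meet the arc `C` again, and at least `d / 2` meet the arc `p C`, each in at most two points. If
`p` is on no secant of `C`, the two families are disjoint, so `3 d ≤ 2 q + 4`, that is `s ^ 2 ≤ 3 s
+ 1`, which is false for `s ≥ 4`. -/
theorem exists_add_eq_of_four_le {α : Eˣ} (hα : IsPrimitive α) (hE : Module.finrank F E = 3)
    (hs : Nat.card F = s ^ 2) (h4 : 4 ≤ s) {p : E} (hp : p ≠ 0)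
    (hp1 : p ^ ((s - 1) * (s ^ 3 + 1)) ≠ 1) :
    ∃ x y : E, x + y = p ∧ x ^ ((s - 1) * (s ^ 3 + 1)) = 1 ∧ y ^ ((s - 1) * (s ^ 3 + 1)) = 1 := by
  classical
  by_contra! hno
  have : FiniteDimensional F E := Module.finite_of_finrank_pos (by omega)
  have : Finite E := Module.finite_of_finite F
  have : Fintype E := Fintype.ofFinite E
  have : Fintype F := Fintype.ofFinite F
  have hM0 : (s - 1) * (s ^ 3 + 1) ≠ 0 := (exp_pos_of_two_le (by omega)).ne'
  have hcardF : Fintype.card F = s ^ 2 := by rw [← hs, Nat.card_eq_fintype_card]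
  have hcardE : Fintype.card E = s ^ 6 := by rw [← card_eq_pow_six hE hs, Nat.card_eq_fintype_card]
  let C : E → Finset E := fun a ↦ Finset.univ.filter fun x : E ↦
      x ^ ((s - 1) * (s ^ 3 + 1)) = a ^ ((s - 1) * (s ^ 3 + 1))
  have hC (a : E) (ha : a ≠ 0) : (C a).card = (s - 1) * (s ^ 3 + 1) :=
    card_filter_pow_eq hα hE hs ha
  have mem_C {a x : E} : x ∈ C a ↔
      x ^ ((s - 1) * (s ^ 3 + 1)) = a ^ ((s - 1) * (s ^ 3 + 1)) := by simp [C]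
  have ne_zero_of_mem {a x : E} (ha : a ≠ 0) (hx : x ∈ C a) : x ≠ 0 := by
    rintro rfl
    rw [mem_C, zero_pow hM0] at hx
    exact pow_ne_zero _ ha hx.symm
  let K : Finset E := Finset.univ.image (algebraMap F E)
  have hK : K.card = s ^ 2 := by
    rw [Finset.card_image_of_injective _ (algebraMap F E).injective, Finset.card_univ, hcardF]
  let K' : Finset E := (Finset.univ.erase (0 : F)).image (algebraMap F E)
  have hK' : K'.card = s ^ 2 - 1 := by
    rw [Finset.card_image_of_injective _ (algebraMap F E).injective,
      Finset.card_erase_of_mem (Finset.mem_univ _), Finset.card_univ, hcardF]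
  let f : E × F → E := fun z ↦ z.1 + algebraMap F E z.2
  have not_mem_D {y : E} (hy : y ∈ C 1 \ K') : ¬ ∃ c : F, y = algebraMap F E c := by
    rintro ⟨c, rfl⟩
    rw [Finset.mem_sdiff] at hy
    have hc : c ≠ 0 := by
      rintro rfl; exact ne_zero_of_mem one_ne_zero hy.1 (map_zero _)
    exact hy.2 (Finset.mem_image.2 ⟨c, by simp [hc], rfl⟩)
  have not_mem_p {y : E} (hy : y ∈ C p) : ¬ ∃ c : F, y = algebraMap F E c := by
    rintro ⟨c, rfl⟩
    have hc : c ≠ 0 := by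
      rintro rfl; exact ne_zero_of_mem hp hy (map_zero _)
    rw [mem_C, algebraMap_pow_eq_one hs hc] at hy
    exact hp1 hy.symm
  let A := ((C 1 \ K') ×ˢ (Finset.univ : Finset F)).image f
  let B := (C p ×ˢ (Finset.univ : Finset F)).image f
  have hA : ((s - 1) * (s ^ 3 + 1) - (s ^ 2 - 1)) * s ^ 2 ≤ A.card := by
    rw [Finset.card_image_of_injOn, Finset.card_product, Finset.card_univ, hcardF]
    · refine Nat.mul_le_mul_right _ ?_
      rw [← hC 1 one_ne_zero, ← hK']
      exact Finset.le_card_sdiff _ _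
    · rintro ⟨y, e⟩ hy ⟨y', e'⟩ hy' heq
      simp only [Finset.coe_product, Set.mem_prod, Finset.mem_coe, Finset.mem_univ, and_true] at hy hy'
      simp only [f] at heq
      have hy'e : y' = y + algebraMap F E (e - e') := by
        rw [map_sub]; linear_combination -heq
      by_cases he : e = e'
      · simp [hy'e, he]
      · exfalso
        have hyC := (Finset.mem_sdiff.1 hy).1
        have hyC' := (Finset.mem_sdiff.1 hy').1
        refine not_mem_D hy (mem_range_of_pow_eq_of_add hE hs
          (ne_zero_of_mem one_ne_zero hyC) (sub_ne_zero.2 he) ?_ ?_ ?_)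
        · rw [← hy'e]; exact ne_zero_of_mem one_ne_zero hyC'
        · simpa [mem_C] using hyC
        · rw [← hy'e]; simpa [mem_C] using hyC'
  have hB : (s - 1) * (s ^ 3 + 1) * s ^ 2 ≤ 2 * B.card := by
    rw [← hC p hp, ← hcardF, ← Finset.card_univ (α := F), ← Finset.card_product]
    refine Finset.card_le_mul_card_image _ 2 fun z _ ↦ ?_
    by_contra! hlt
    obtain ⟨⟨y, e⟩, ⟨y₁, e₁⟩, ⟨y₂, e₂⟩, h, h₁, h₂, hn₁, hn₂, hn₁₂⟩ := Finset.two_lt_card_iff.1 hlt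
    simp only [Finset.mem_filter, Finset.mem_product, Finset.mem_univ, and_true, f] at h h₁ h₂
    have hy₁ : y₁ = y + algebraMap F E (e - e₁) := by
      rw [map_sub]; linear_combination h₁.2 - h.2
    have hy₂ : y₂ = y + algebraMap F E (e - e₂) := by
      rw [map_sub]; linear_combination h₂.2 - h.2
    have he₁ : e ≠ e₁ := by rintro rfl; simp [hy₁] at hn₁
    have he₂ : e ≠ e₂ := by rintro rfl; simp [hy₂] at hn₂
    have he₁₂ : e₁ ≠ e₂ := by rintro rfl; simp [hy₁, hy₂] at hn₁₂
    refine not_mem_p h.1 (mem_range_of_pow_eq_of_add_of_add hE hs (ne_zero_of_mem hp h.1)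
      (sub_ne_zero.2 he₁) (sub_ne_zero.2 he₂) ?_ ?_ ?_ ?_ ?_)
    · exact fun hh ↦ he₁₂ (sub_right_injective hh)
    · rw [← hy₁]; exact ne_zero_of_mem hp h₁.1
    · rw [← hy₂]; exact ne_zero_of_mem hp h₂.1
    · rw [← hy₁, mem_C.1 h₁.1, mem_C.1 h.1]
    · rw [← hy₂, mem_C.1 h₂.1, mem_C.1 h.1]
  have hAB : Disjoint A B := by
    rw [Finset.disjoint_left]
    rintro z hzA hzB
    obtain ⟨⟨y, e⟩, hy, rfl⟩ := Finset.mem_image.1 hzA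
    obtain ⟨⟨y', e'⟩, hy', heq⟩ := Finset.mem_image.1 hzB
    simp only [Finset.mem_product, Finset.mem_univ, and_true, f] at hy hy' heq
    have hyC := mem_C.1 (Finset.mem_sdiff.1 hy).1
    rw [one_pow] at hyC
    have hy'0 := ne_zero_of_mem hp hy'
    have hyC' := mem_C.1 hy'
    have heq' : y' = y + algebraMap F E (e - e') := by rw [map_sub]; linear_combination heq
    by_cases he : e = e'
    · rw [he, sub_self, map_zero, add_zero] at heq'
      rw [heq', hyC] at hyC'
      exact hp1 hyC'.symm
    -- Multiplication by `p / y'` preserves `C` and moves `y'` to `p`, so it turns a secant through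
    -- `y'` into a secant through `p`.
    · have hu : (p / y') ^ ((s - 1) * (s ^ 3 + 1)) = 1 := by
        rw [div_pow, hyC', div_self (pow_ne_zero _ hp)]
      refine hno (p / y' * y) (p / y' * algebraMap F E (e - e')) ?_ ?_ ?_
      · rw [← mul_add, ← heq', div_mul_cancel₀ _ hy'0]
      · rw [mul_pow, hu, hyC, one_mul]
      · rw [mul_pow, hu, algebraMap_pow_eq_one hs (sub_ne_zero.2 he), one_mul]
  have hsub : A ∪ B ⊆ Finset.univ \ K := by
    intro z hz
    rw [Finset.mem_sdiff]
    refine ⟨Finset.mem_univ _, fun hzK ↦ ?_⟩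
    obtain ⟨c, -, rfl⟩ := Finset.mem_image.1 hzK
    rcases Finset.mem_union.1 hz with h | h
    · obtain ⟨⟨y, e⟩, hy, heq⟩ := Finset.mem_image.1 h
      simp only [Finset.mem_product, Finset.mem_univ, and_true, f] at hy heq
      exact not_mem_D hy ⟨c - e, by rw [map_sub, ← heq]; ring⟩
    · obtain ⟨⟨y, e⟩, hy, heq⟩ := Finset.mem_image.1 h
      simp only [Finset.mem_product, Finset.mem_univ, and_true, f] at hy heq
      exact not_mem_p hy ⟨c - e, by rw [map_sub, ← heq]; ring⟩
  have hle := Finset.card_le_card hsub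
  rw [Finset.card_union_of_disjoint hAB, Finset.card_sdiff_of_subset (Finset.subset_univ _),
    Finset.card_univ, hcardE, hK] at hle
  obtain ⟨r, rfl⟩ : ∃ r, s = r + 4 := ⟨s - 4, by omega⟩
  have e₁ : r + 4 - 1 = r + 3 := by omega
  have e₂ : (r + 4) ^ 2 - 1 = r ^ 2 + 8 * r + 15 := by
    rw [Nat.sub_eq_iff_eq_add (by nlinarith)]; ring
  have e₃ : (r + 3) * ((r + 4) ^ 3 + 1) - (r ^ 2 + 8 * r + 15) =
      r ^ 4 + 15 * r ^ 3 + 83 * r ^ 2 + 201 * r + 180 := by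
    rw [Nat.sub_eq_iff_eq_add (by ring_nf; nlinarith [Nat.zero_le (r ^ 3), Nat.zero_le (r ^ 4)])]
    ring
  have e₄ : (r + 4) ^ 6 - (r + 4) ^ 2 = (r + 4) ^ 2 * ((r + 4) ^ 4 - 1) := by
    rw [Nat.mul_sub]; ring_nf
  have e₅ : (r + 4) ^ 4 - 1 = r ^ 4 + 16 * r ^ 3 + 96 * r ^ 2 + 256 * r + 255 := by
    rw [Nat.sub_eq_iff_eq_add (Nat.pow_pos (by omega))]; ring
  rw [e₁, e₂, e₃] at hA
  rw [e₁] at hB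
  rw [e₄, e₅] at hle
  have hfin : (r + 4) ^ 2 * (2 * (r ^ 4 + 15 * r ^ 3 + 83 * r ^ 2 + 201 * r + 180) +
      (r + 3) * ((r + 4) ^ 3 + 1)) ≤
      (r + 4) ^ 2 * (2 * (r ^ 4 + 16 * r ^ 3 + 96 * r ^ 2 + 256 * r + 255)) := by
    linarith
  have := Nat.le_of_mul_le_mul_left hfin (Nat.pow_pos (by omega))
  nlinarith [Nat.zero_le (r ^ 3), Nat.zero_le (r ^ 4), Nat.zero_le (r ^ 2)]

end Field

/-! ### Completeness for `s = 3`: quadratics over the field of order 27 -/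

section Field

variable {F E : Type*} [Field F] [Finite F] [Field E] [Algebra F E] {s : ℕ}

theorem three_eq_zero_of_card_eq_nine (hs : Nat.card F = 3 ^ 2) : (3 : E) = 0 := by
  have : Fintype F := Fintype.ofFinite F
  have h : ((Fintype.card F : ℕ) : F) = 0 := Nat.cast_card_eq_zero F
  rw [← Nat.card_eq_fintype_card, hs] at h
  have h' : (3 : F) = 0 := by
    rw [Nat.cast_pow] at h
    exact pow_eq_zero_iff (two_ne_zero) |>.1 h
  rw [← map_ofNat (algebraMap F E) 3, h', map_zero]

/-- Here `x ^ 28` is the norm to the field of order 27. Requiring norms `a` and `b` for `x = p z`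
and `y = p (1 - z)` fixes the norm `a / m` and trace `(m + a - b) / m` of `z`, where `m = p ^ 28`.
Up to the factor `m ^ 2`, the quadratic for `z` has discriminant `D`; `hD` says that `D` is a
nonsquare in the field of order 27, so its roots are conjugate and have the prescribed norm. -/
theorem exists_add_eq_of_discriminant (hE : Module.finrank F E = 3) (hs : Nat.card F = 3 ^ 2)
    {p a b : E} (hp : p ≠ 0) (ha : a ^ 2 = 1) (hb : b ^ 2 = 1)
    (hD : ((p ^ 28) ^ 2 - 2 * (a + b) * p ^ 28 + (a - b) ^ 2) ^ 13 = -1) :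
    ∃ x y : E, x + y = p ∧ x ^ 56 = 1 ∧ y ^ 56 = 1 := by
  have : FiniteDimensional F E := Module.finite_of_finrank_pos (by omega)
  have : Finite E := Module.finite_of_finite F
  have : Fintype E := Fintype.ofFinite E
  have h3 : (3 : E) = 0 := three_eq_zero_of_card_eq_nine hs
  have hcardE : Fintype.card E = 729 := by
    rw [← Nat.card_eq_fintype_card, card_eq_pow_six hE hs]; norm_num
  have h2 : ringChar E ≠ 2 := by
    intro h
    have : (2 : E) = 0 := by
      have := ringChar.Nat.cast_ringChar (R := E)
      rw [h] at this; exact_mod_cast this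
    have h1 : (1 : E) = 0 := by linear_combination h3 - this
    exact one_ne_zero h1
  obtain ⟨m, hm⟩ : ∃ m, m = p ^ 28 := ⟨_, rfl⟩
  rw [← hm] at hD
  have hm0 : m ≠ 0 := hm ▸ pow_ne_zero _ hp
  have hp728 : p ^ 728 = 1 := by
    have := FiniteField.pow_card_sub_one_eq_one p hp
    rwa [hcardE] at this
  have hm27 : m ^ 27 = m := by
    rw [hm, ← pow_mul, show 28 * 27 = 728 + 28 by norm_num, pow_add, hp728, one_mul]
  have pow27 (x y : E) : (x + y) ^ 27 = x ^ 27 + y ^ 27 := pow_pow_three_add hs x y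
  set D := m ^ 2 - 2 * (a + b) * m + (a - b) ^ 2 with hDdef
  have hD0 : D ≠ 0 := by
    intro h; rw [h] at hD; norm_num at hD
  obtain ⟨δ, hδ⟩ : IsSquare D := by
    rw [FiniteField.isSquare_iff h2 hD0, hcardE, show 729 / 2 = 13 * 28 by norm_num, pow_mul, hD]
    norm_num
  have hδ27 : δ ^ 27 = -δ := by
    calc δ ^ 27 = (δ * δ) ^ 13 * δ := by ring
      _ = -δ := by rw [← hδ, hD]; ring
  have pow27_self {c : E} (hc : c ^ 2 = 1) : c ^ 27 = c := by
    calc c ^ 27 = (c ^ 2) ^ 13 * c := by ring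
      _ = c := by rw [hc]; ring
  have neg27 (c : E) : (-c) ^ 27 = -c ^ 27 := by ring
  have main (a b δ : E) (ha : a ^ 2 = 1) (hb : b ^ 2 = 1) (hδ27 : δ ^ 27 = -δ)
      (hδ : m ^ 2 - 2 * (a + b) * m + (a - b) ^ 2 = δ * δ) :
      (-p * (m + a - b + δ) / m) ^ 56 = 1 := by
    have hN : (m + a - b + δ) ^ 28 = a * m := by
      have : (m + a - b + δ) ^ 27 = m + a - b - δ := by
        rw [pow27, sub_eq_add_neg (m + a), pow27, pow27, neg27, hδ27, hm27, pow27_self ha,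
          pow27_self hb]
        ring
      rw [pow_succ, this]
      linear_combination hδ + a * m * h3
    have hN' : (-p * (m + a - b + δ) / m) ^ 28 = a := by
      rw [div_pow, mul_pow, hN, Even.neg_pow (by decide), ← hm, show m ^ 28 = m ^ 27 * m by ring,
        hm27]
      field_simp
    rw [show 56 = 28 * 2 by norm_num, pow_mul, hN', ha]
  -- The quadratic formula, with `1 / 2 = -1` in characteristic 3; the second vector comes from
  -- swapping `a` and `b` and negating `δ`.
  refine ⟨-p * (m + a - b + δ) / m, -p * (m + b - a + -δ) / m, ?_,
    main a b δ ha hb hδ27 hδ, main b a (-δ) hb ha ?_ ?_⟩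
  · field_simp
    linear_combination -m * h3
  · rw [neg27, hδ27]
  · rw [neg_mul_neg, ← hδ, hDdef]; ring

theorem exists_add_eq_of_eq_three (hE : Module.finrank F E = 3) (hs : Nat.card F = 3 ^ 2)
    {p : E} (hp : p ≠ 0) (hp1 : p ^ 56 ≠ 1) :
    ∃ x y : E, x + y = p ∧ x ^ 56 = 1 ∧ y ^ 56 = 1 := by
  have h3 : (3 : E) = 0 := three_eq_zero_of_card_eq_nine hs
  have hp728 : p ^ 728 = 1 := by
    have h : p ^ 3 ^ 6 = p := pow_six_eq_self hE hs p
    rw [show 3 ^ 6 = 728 + 1 by norm_num, pow_succ] at h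
    exact mul_eq_right₀ hp |>.1 h
  by_contra hno
  obtain ⟨m, hm⟩ : ∃ m, m = p ^ 28 := ⟨_, rfl⟩
  have hm0 : m ≠ 0 := hm ▸ pow_ne_zero _ hp
  have hm2 : m ^ 2 ≠ 1 := by rwa [hm, ← pow_mul]
  have hm26 : m ^ 26 = 1 := by rw [hm, ← pow_mul]; exact hp728
  have hm27 : m ^ 27 = m := by rw [pow_succ, hm26, one_mul]
  have pow27 (x y : E) : (x + y) ^ 27 = x ^ 27 + y ^ 27 := pow_pow_three_add hs x y
  have pow3 (x y : E) : (x + y) ^ 3 = x ^ 3 + y ^ 3 := add_pow_of_card_eq_sq hs x y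
  -- If no decomposition exists, each discriminant fails to be a nonsquare in the field of order 27;
  -- being nonzero, it has 13th power 1.
  have sq_case (D : E) (hD0 : D ≠ 0) (hD27 : D ^ 27 = D) (hD : D ^ 13 ≠ -1) : D ^ 13 = 1 := by
    have h26 : D ^ 26 = 1 := by
      rw [show 27 = 26 + 1 by norm_num, pow_succ] at hD27
      exact mul_eq_right₀ hD0 |>.1 hD27
    have : (D ^ 13 - 1) * (D ^ 13 + 1) = 0 := by linear_combination h26
    rcases mul_eq_zero.1 this with h | h
    · exact sub_eq_zero.1 h
    · exact absurd (eq_neg_of_add_eq_zero_left h) hD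
  have hm1 : m - 1 ≠ 0 := by
    intro h; rw [sub_eq_zero.1 h] at hm2; norm_num at hm2
  have hm1' : m + 1 ≠ 0 := by
    intro h; rw [eq_neg_of_add_eq_zero_left h] at hm2; norm_num at hm2
  have hm21 : m ^ 2 + 1 ≠ 0 := by
    intro h
    have : m ^ 26 = -1 := by
      rw [show 26 = 2 * 13 by norm_num, pow_mul, eq_neg_of_add_eq_zero_left h]; norm_num
    rw [hm26] at this
    have h1 : (1 : E) = 0 := by linear_combination h3 - this
    exact one_ne_zero h1
  have q₁ : (m * (m - 1)) ^ 13 = 1 := by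
    refine sq_case _ (mul_ne_zero hm0 hm1) ?_ fun h ↦ hno ?_
    · rw [mul_pow, sub_eq_add_neg, pow27, hm27]; norm_num
    · refine exists_add_eq_of_discriminant (a := 1) (b := 1) hE hs hp (by norm_num)
        (by norm_num) ?_
      refine Eq.trans ?_ h; congr 1; rw [← hm]; linear_combination -m * h3
  have q₂ : (m * (m + 1)) ^ 13 = 1 := by
    refine sq_case _ (mul_ne_zero hm0 hm1') ?_ fun h ↦ hno ?_
    · rw [mul_pow, pow27, hm27]; norm_num
    · refine exists_add_eq_of_discriminant (a := -1) (b := -1) hE hs hp (by norm_num)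
        (by norm_num) ?_
      refine Eq.trans ?_ h; congr 1; rw [← hm]; linear_combination m * h3
  have q₃ : (m ^ 2 + 1) ^ 13 = 1 := by
    refine sq_case _ hm21 ?_ fun h ↦ hno ?_
    · rw [pow27, ← pow_mul, mul_comm, pow_mul, hm27]; norm_num
    · refine exists_add_eq_of_discriminant (a := 1) (b := -1) hE hs hp (by norm_num)
        (by norm_num) ?_
      refine Eq.trans ?_ h; congr 1; rw [← hm]; linear_combination h3
  -- The 13th power is the norm from the field of order 27 to the prime field, so `m`, `b`, `c`
  -- below are conjugates and `ε` is the norm of `m`.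
  have pow13 (x : E) : x ^ 13 = x * x ^ 3 * (x ^ 3) ^ 3 := by ring
  set b := m ^ 3 with hb
  set c := b ^ 3 with hc
  set ε := m * b * c with hε
  have hε13 : m ^ 13 = ε := pow13 m
  have hε2 : ε ^ 2 = 1 := by rw [← hε13, ← pow_mul]; exact hm26
  have p₁ : (m - 1) ^ 13 = (m - 1) * (b - 1) * (c - 1) := by
    rw [pow13, sub_eq_add_neg, pow3, ← hb, show (-1 : E) ^ 3 = -1 by norm_num, pow3, ← hc,
      show (-1 : E) ^ 3 = -1 by norm_num]
    ring
  have p₂ : (m + 1) ^ 13 = (m + 1) * (b + 1) * (c + 1) := by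
    rw [pow13, pow3, ← hb, one_pow, pow3, ← hc, one_pow]
  have p₃ : (m ^ 2 + 1) ^ 13 = (m ^ 2 + 1) * (b ^ 2 + 1) * (c ^ 2 + 1) := by
    rw [pow13, pow3, one_pow, pow3, one_pow, hc, hb]
    ring
  rw [mul_pow, hε13, p₁] at q₁
  rw [mul_pow, hε13, p₂] at q₂
  rw [p₃] at q₃
  have r₁ : (m - 1) * (b - 1) * (c - 1) = ε := by linear_combination ε * q₁ -
    (m - 1) * (b - 1) * (c - 1) * hε2
  have r₂ : (m + 1) * (b + 1) * (c + 1) = ε := by linear_combination ε * q₂ -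
    (m + 1) * (b + 1) * (c + 1) * hε2
  have e₁ : m + b + c = 0 := by
    linear_combination (m + b + c) * h3 - r₁ - r₂ - 2 * hε
  have e₂ : m * b + m * c + b * c = -1 := by
    linear_combination r₂ - e₁ + hε
  -- With elementary symmetric functions `0`, `-1`, `ε` of `m`, `b`, `c`, the norm of `m ^ 2 + 1` is
  -- `5 = -1`, whereas `q₃` says 1.
  have h1 : (1 : E) = 0 := by
    linear_combination q₃ - hε2 + (ε + m * b * c) * hε - (m * b + m * c + b * c - 1) * e₂ +
      2 * m * b * c * e₁ - (m + b + c) * e₁ + 2 * e₂ - h3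
  exact one_ne_zero h1

theorem exists_add_eq {α : Eˣ} (hα : IsPrimitive α) (hE : Module.finrank F E = 3)
    (hs : Nat.card F = s ^ 2) (h3 : 3 ≤ s) {p : E} (hp : p ≠ 0)
    (hp1 : p ^ ((s - 1) * (s ^ 3 + 1)) ≠ 1) :
    ∃ x y : E, x + y = p ∧ x ^ ((s - 1) * (s ^ 3 + 1)) = 1 ∧ y ^ ((s - 1) * (s ^ 3 + 1)) = 1 := by
  rcases h3.eq_or_lt with rfl | h4
  · exact exists_add_eq_of_eq_three hE hs hp hp1
  · exact exists_add_eq_of_four_le hα hE hs h4 hp hp1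

end Field

/-! ### From vectors to points: orbits, their size, and completeness -/

section Points

variable {F E : Type*} [Field F] [Finite F] [Field E] [Algebra F E] {s : ℕ}

omit [Finite F] in
-- The bridge between counting vectors and counting points: a scalar-invariant set without 0
-- contains all `q - 1` multiples of each representative.
theorem ncard_eq_mul_ncard_setOf_rep_mem [Finite E] (T : Set E) (hT0 : (0 : E) ∉ T)
    (hT : ∀ c : F, c ≠ 0 → ∀ x ∈ T, c • x ∈ T) :
    T.ncard = (Nat.card F - 1) * {P : ℙ F E | P.rep ∈ T}.ncard := by
  have himage : T = (fun z : ℙ F E × Fˣ ↦ z.2 • z.1.rep) ''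
      ({P : ℙ F E | P.rep ∈ T} ×ˢ Set.univ) := by
    ext x
    constructor
    · intro hx
      have hx0 : x ≠ 0 := by rintro rfl; exact hT0 hx
      obtain ⟨a, ha⟩ := Projectivization.exists_smul_eq_mk_rep F x hx0
      refine ⟨(Projectivization.mk F x hx0, a⁻¹), ⟨?_, Set.mem_univ _⟩, ?_⟩
      · change (Projectivization.mk F x hx0).rep ∈ T
        rw [← ha]
        exact hT a a.ne_zero x hx
      · change a⁻¹ • (Projectivization.mk F x hx0).rep = x
        rw [← ha, inv_smul_smul]
    · rintro ⟨⟨P, a⟩, ⟨hP, -⟩, rfl⟩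
      exact hT a a.ne_zero _ hP
  have hinj : Function.Injective (fun z : ℙ F E × Fˣ ↦ z.2 • z.1.rep) := by
    rintro ⟨P, a⟩ ⟨Q, b⟩ h
    change a • P.rep = b • Q.rep at h
    have hPQ : P = Q := by
      refine eq_of_rep_eq_smul (c := ((a⁻¹ * b : Fˣ) : F)) ?_
      rw [← Units.smul_def, mul_smul, ← h, inv_smul_smul]
    subst hPQ
    have : a = b := by
      rw [Units.smul_def, Units.smul_def] at h
      exact Units.ext (smul_left_injective F P.rep_nonzero h)
    rw [this]
  conv_lhs => rw [himage]
  rw [Set.ncard_image_of_injective _ hinj, Set.ncard_prod, Set.ncard_univ, Nat.card_units, mul_comm]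

theorem rep_mk_pow (hs : Nat.card F = s ^ 2) {x : E} (hx : x ≠ 0) :
    (Projectivization.mk F x hx).rep ^ ((s - 1) * (s ^ 3 + 1)) =
      x ^ ((s - 1) * (s ^ 3 + 1)) := by
  obtain ⟨a, ha⟩ := Projectivization.exists_smul_eq_mk_rep F x hx
  rw [← ha, Units.smul_def, smul_pow_eq hs a.ne_zero]

theorem sq_add_eq_mul (h2 : 2 ≤ s) :
    (s ^ 2) ^ 2 + s ^ 2 + 1 = (s ^ 2 - s + 1) * (s ^ 2 + s + 1) := by
  obtain ⟨r, rfl⟩ : ∃ r, s = r + 1 := ⟨s - 1, by omega⟩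
  have : (r + 1) ^ 2 - (r + 1) = r ^ 2 + r := by
    rw [Nat.sub_eq_iff_eq_add (by nlinarith)]; ring
  rw [this]; ring

theorem singerIndex_eq (hs : Nat.card F = s ^ 2) :
    singerIndex F (s ^ 2 - s + 1) = s ^ 2 + s + 1 := by
  rw [singerIndex, hs, sq_add_eq_mul (two_le_of_card_eq_sq hs), Nat.mul_div_cancel_left _ (by omega)]

omit [Finite F] in
theorem sigma_pow_zpow_apply_mk (α : Eˣ) (t : ℕ) (k : ℤ) {x : E} (hx : x ≠ 0) :
    ((sigma F α ^ t) ^ k) (Projectivization.mk F x hx) =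
      Projectivization.mk F (((α ^ t) ^ k : Eˣ) * x) (mul_ne_zero (Units.ne_zero _) hx) := by
  have : (sigma F α ^ t) ^ k = MulAction.toPermHom Eˣ (ℙ F E) ((α ^ t) ^ k) := by
    rw [map_zpow, map_pow]; rfl
  rw [this, MulAction.toPermHom_apply, MulAction.toPerm_apply, Projectivization.smul_mk]
  rfl

omit [Finite F] in
theorem mem_singerOrbit_iff (α : Eˣ) (d u : ℕ) (P : ℙ F E) :
    P ∈ singerOrbit F α d u ↔
      ∃ k : ℤ, ((sigma F α ^ singerIndex F d) ^ k) (point F α u) = P := by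
  constructor
  · rintro ⟨⟨_, k, rfl⟩, rfl⟩
    exact ⟨k, rfl⟩
  · rintro ⟨k, rfl⟩
    exact ⟨⟨_, k, rfl⟩, rfl⟩

/-- `α` has order `(s ^ 2 + s + 1) * M`, so equality of the `M`-th powers of `α ^ j` and `α ^ u`
means that `j - u` is a multiple of `t = s ^ 2 + s + 1`. -/
theorem singerOrbit_eq {α : Eˣ} (hα : IsPrimitive α) (hE : Module.finrank F E = 3)
    (hs : Nat.card F = s ^ 2) (u : ℕ) :
    singerOrbit F α (s ^ 2 - s + 1) u = {P : ℙ F E | P.rep ^ ((s - 1) * (s ^ 3 + 1)) =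
      ((α : E) ^ u) ^ ((s - 1) * (s ^ 3 + 1))} := by
  have h2 := two_le_of_card_eq_sq hs
  have hM := exp_pos_of_two_le h2
  have hroot := hα.isPrimitiveRoot hE hs
  rw [pow_six_sub_one_eq h2] at hroot
  ext P
  rw [mem_singerOrbit_iff, singerIndex_eq hs, Set.mem_ofPred_eq]
  simp only [point, sigma_pow_zpow_apply_mk]
  constructor
  · rintro ⟨k, rfl⟩
    rw [rep_mk_pow hs]
    have : (((α ^ (s ^ 2 + s + 1)) ^ k : Eˣ) : E) ^ ((s - 1) * (s ^ 3 + 1)) = 1 := by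
      rw [← Units.val_pow_eq_pow_val, Units.val_eq_one, ← zpow_natCast, zpow_comm, zpow_natCast,
        ← pow_mul, (IsPrimitiveRoot.coe_units_iff.1 hroot).pow_eq_one, one_zpow]
    rw [mul_pow, this, one_mul, Units.val_pow_eq_pow_val]
  · intro hP
    obtain ⟨j, hj⟩ := hα (Units.mk0 P.rep P.rep_nonzero)
    simp only at hj
    have hPj : ((α ^ j : Eˣ) : E) = P.rep := by rw [hj, Units.val_mk0]
    rw [← hPj] at hP
    have hP' : (α ^ (j - u)) ^ ((s - 1) * (s ^ 3 + 1)) = 1 := by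
      rw [zpow_sub, ← div_eq_mul_inv, div_pow, div_eq_one, zpow_natCast]
      exact Units.ext (by simpa using hP)
    rw [← zpow_natCast, ← zpow_mul,
      (IsPrimitiveRoot.coe_units_iff.1 hroot).zpow_eq_one_iff_dvd] at hP'
    push_cast at hP'
    have hdvd : ((s ^ 2 + s + 1 : ℕ) : ℤ) ∣ j - u := by
      push_cast
      refine Int.dvd_of_mul_dvd_mul_right ?_ hP'
      exact_mod_cast hM.ne'
    obtain ⟨k, hk⟩ := hdvd
    refine ⟨k, ?_⟩
    rw [← P.mk_rep]
    congr 1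
    rw [← Units.val_mul, ← hPj, ← zpow_natCast, ← zpow_natCast α u, ← zpow_mul, ← hk, ← zpow_add]
    congr 2
    ring

theorem ncard_singerOrbit {α : Eˣ} (hα : IsPrimitive α) (hE : Module.finrank F E = 3)
    (hs : Nat.card F = s ^ 2) (u : ℕ) :
    (singerOrbit F α (s ^ 2 - s + 1) u).ncard = s ^ 2 - s + 1 := by
  classical
  have : FiniteDimensional F E := Module.finite_of_finrank_pos (by omega)
  have : Finite E := Module.finite_of_finite F
  have : Fintype E := Fintype.ofFinite E
  have h2 := two_le_of_card_eq_sq hs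
  have hu : (α : E) ^ u ≠ 0 := pow_ne_zero _ α.ne_zero
  have h := ncard_eq_mul_ncard_setOf_rep_mem (F := F) {x : E | x ^ ((s - 1) * (s ^ 3 + 1)) =
      ((α : E) ^ u) ^ ((s - 1) * (s ^ 3 + 1))}
    (fun h ↦ pow_ne_zero _ hu (h.symm.trans (zero_pow (exp_pos_of_two_le h2).ne')))
    (fun c hc x hx ↦ (smul_pow_eq hs hc x).trans hx)
  have hcard := card_filter_pow_eq hα hE hs hu
  rw [← Set.ncard_coe_finset, Finset.coe_filter_univ, h, hs] at hcard
  rw [singerOrbit_eq hα hE hs]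
  have : 1 < s ^ 2 := by nlinarith
  exact Nat.eq_of_mul_eq_mul_left (by omega) (hcard.trans (exp_eq_mul h2))

/-- The order is at most `d` because `α ^ (t * d)` is a scalar from `F`, and at least `d` because an
orbit has `d` points. -/
theorem card_singerSubgroup {α : Eˣ} (hα : IsPrimitive α) (hE : Module.finrank F E = 3)
    (hs : Nat.card F = s ^ 2) :
    Nat.card (singerSubgroup F α (s ^ 2 - s + 1)) = s ^ 2 - s + 1 := by
  have : FiniteDimensional F E := Module.finite_of_finrank_pos (by omega)
  have : Finite E := Module.finite_of_finite F
  have h2 := two_le_of_card_eq_sq hs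
  apply le_antisymm
  · rw [singerSubgroup, Nat.card_zpowers]
    refine orderOf_le_of_pow_eq_one (by omega) ?_
    ext P : 1
    rw [← P.mk_rep, ← zpow_natCast, sigma_pow_zpow_apply_mk, Equiv.Perm.one_apply, singerIndex_eq hs,
      Projectivization.mk_eq_mk_iff']
    have h1 : 1 < s ^ 2 := by nlinarith
    have hone : ((α ^ (s ^ 2 + s + 1)) ^ (s ^ 2 - s + 1)) ^ (s ^ 2 - 1) = 1 := by
      rw [← pow_mul, ← pow_mul, mul_comm (s ^ 2 - s + 1), ← exp_eq_mul h2,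
        ← pow_six_sub_one_eq h2,
        (IsPrimitiveRoot.coe_units_iff.1 (hα.isPrimitiveRoot hE hs)).pow_eq_one]
    have hpow : ((α ^ (s ^ 2 + s + 1)) ^ (s ^ 2 - s + 1)) ^ s ^ 2 =
        (α ^ (s ^ 2 + s + 1)) ^ (s ^ 2 - s + 1) :=
      (pow_sub_one_mul (by omega) _).symm.trans (by rw [hone, one_mul])
    obtain ⟨c, hc⟩ := exists_algebraMap_eq_of_pow_sq (F := F) hs
      (x := (((α ^ (s ^ 2 + s + 1)) ^ (s ^ 2 - s + 1) : Eˣ) : E))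
      (by rw [← Units.val_pow_eq_pow_val, hpow])
    exact ⟨c, by rw [zpow_natCast, ← hc, Algebra.smul_def]⟩
  · conv_lhs => rw [← ncard_singerOrbit hα hE hs 0]
    exact Finite.card_range_le _

theorem isKestenbandEbertArc_singerOrbit {α : Eˣ} (hα : IsPrimitive α)
    (hE : Module.finrank F E = 3) (hs : Nat.card F = s ^ 2) (u : ℕ) :
    IsKestenbandEbertArc F (singerOrbit F α (s ^ 2 - s + 1) u) := by
  refine ⟨?_, α, singerSubgroup F α (s ^ 2 - s + 1), point F α u, s, hα, ?_, hs, ?_, rfl⟩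
  · rw [singerOrbit_eq hα hE hs]
    exact isArc_setOf_rep_pow_eq hE hs _
  · exact Subgroup.zpowers_le.2 (Subgroup.npow_mem_zpowers _ _)
  · rw [card_singerSubgroup hα hE hs, hs]

theorem isCompleteArc_singerOrbit {α : Eˣ} (hα : IsPrimitive α)
    (hE : Module.finrank F E = 3) (hs : Nat.card F = s ^ 2) (h3 : 3 ≤ s) (u : ℕ) :
    IsCompleteArc F (singerOrbit F α (s ^ 2 - s + 1) u) := by
  refine ⟨(isKestenbandEbertArc_singerOrbit hα hE hs u).1, fun K hK hle P hPK ↦ ?_⟩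
  by_contra hP
  have hM := (exp_pos_of_two_le (two_le_of_card_eq_sq hs)).ne'
  rw [singerOrbit_eq hα hE hs] at hle hP
  have hu : (α : E) ^ u ≠ 0 := pow_ne_zero _ α.ne_zero
  have hp1 : (P.rep / (α : E) ^ u) ^ ((s - 1) * (s ^ 3 + 1)) ≠ 1 := by
    rw [div_pow, Ne, div_eq_one_iff_eq (pow_ne_zero _ hu)]
    exact hP
  obtain ⟨x, y, hxy, hx, hy⟩ := exists_add_eq hα hE hs h3 (div_ne_zero P.rep_nonzero hu) hp1
  have hx0 : x ≠ 0 := by rintro rfl; rw [zero_pow hM] at hx; exact zero_ne_one hx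
  have hy0 : y ≠ 0 := by rintro rfl; rw [zero_pow hM] at hy; exact zero_ne_one hy
  have hX0 := mul_ne_zero hu hx0
  have hY0 := mul_ne_zero hu hy0
  have hPxy : (α : E) ^ u * x + (α : E) ^ u * y = P.rep := by
    rw [← mul_add, hxy, mul_div_cancel₀ _ hu]
  have hX : Projectivization.mk F _ hX0 ∈ {P : ℙ F E | P.rep ^ ((s - 1) * (s ^ 3 + 1)) =
      ((α : E) ^ u) ^ ((s - 1) * (s ^ 3 + 1))} := by
    rw [Set.mem_ofPred_eq, rep_mk_pow hs, mul_pow, hx, mul_one]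
  have hY : Projectivization.mk F _ hY0 ∈ {P : ℙ F E | P.rep ^ ((s - 1) * (s ^ 3 + 1)) =
      ((α : E) ^ u) ^ ((s - 1) * (s ^ 3 + 1))} := by
    rw [Set.mem_ofPred_eq, rep_mk_pow hs, mul_pow, hy, mul_one]
  have hXY : Projectivization.mk F _ hX0 ≠ Projectivization.mk F _ hY0 := by
    intro h
    obtain ⟨c, hc⟩ := (Projectivization.mk_eq_mk_iff' _ _ _ _ _).1 h
    have hPc : P.rep = (c + 1) • ((α : E) ^ u * y) := by
      rw [← hPxy, ← hc, add_smul, one_smul]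
    have hc0 : c + 1 ≠ 0 := by
      intro h0; rw [h0, zero_smul] at hPc; exact P.rep_nonzero hPc
    apply hP
    rw [Set.mem_ofPred_eq, hPc, smul_pow_eq hs hc0, mul_pow, hy, mul_one]
  refine hK _ (hle hX) _ (hle hY) P hPK hXY (fun h ↦ hP (h ▸ hX)) (fun h ↦ hP (h ▸ hY)) ?_
  refine ⟨_, ⟨Submodule.span F {(α : E) ^ u * x, (α : E) ^ u * y}, ?_, rfl⟩, ?_⟩
  · have hli : LinearIndependent F ![(α : E) ^ u * x, (α : E) ^ u * y] := by
      rw [LinearIndependent.pair_iff' hX0]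
      intro c hc
      exact hXY ((Projectivization.mk_eq_mk_iff' _ _ _ _ _).2 ⟨c, hc⟩).symm
    have := finrank_span_eq_card hli
    rwa [Matrix.range_cons, Matrix.range_cons, Matrix.range_empty, Set.union_empty,
      Set.singleton_union, Fintype.card_fin] at this
  · simp only [Set.mem_ofPred_eq, Projectivization.submodule_mk,
      Submodule.span_singleton_le_iff_mem]
    refine ⟨Submodule.subset_span (by simp), Submodule.subset_span (by simp), ?_⟩
    rw [Projectivization.submodule_eq, Submodule.span_singleton_le_iff_mem, ← hPxy]
    exact add_mem (Submodule.subset_span (by simp)) (Submodule.subset_span (by simp))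

end Points

/-! ### The first two moments of the intersection numbers -/

section Counting

variable {F E : Type*} [Field F] [Finite F] [Field E] [Algebra F E] {s : ℕ}

omit [Finite F] in
-- The multipliers preserving `W` form a subalgebra. As the degree 3 is prime, it is `F` or `E`, and
-- `E` would force `W` to be everything.
theorem exists_algebraMap_eq_of_mul_mem (hE : Module.finrank F E = 3) {W : Submodule F E}
    (hW : Module.finrank F W = 2) {g : E} (hg : ∀ x ∈ W, g * x ∈ W) :
    ∃ c : F, algebraMap F E c = g := by
  let A : Subalgebra F E :=
    { carrier := {h | ∀ x ∈ W, h * x ∈ W}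
      mul_mem' := fun {a b} ha hb x hx ↦ by rw [mul_assoc]; exact ha _ (hb _ hx)
      add_mem' := fun {a b} ha hb x hx ↦ by rw [add_mul]; exact add_mem (ha _ hx) (hb _ hx)
      algebraMap_mem' := fun c x hx ↦ by rw [← Algebra.smul_def]; exact W.smul_mem c hx }
  have hgA : g ∈ A := hg
  have := Subalgebra.isSimpleOrder_of_finrank_prime F E (hE ▸ Nat.prime_three)
  rcases eq_bot_or_eq_top A with h | h
  · rw [h] at hgA
    exact Algebra.mem_bot.1 hgA
  · exfalso
    have hW0 : W ≠ ⊥ := by rintro rfl; simp at hW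
    obtain ⟨x, hx, hx0⟩ := Submodule.exists_mem_ne_zero_of_ne_bot hW0
    have htop : W = ⊤ := by
      rw [eq_top_iff]
      intro y _
      have hy : y / x ∈ A := h ▸ Algebra.mem_top
      have := hy x hx
      rwa [div_mul_cancel₀ _ hx0] at this
    rw [htop, finrank_top, hE] at hW
    omega

omit [Finite F] in
theorem finrank_inf_comap_mulLeft (hE : Module.finrank F E = 3) {W : Submodule F E}
    (hW : Module.finrank F W = 2) {g : E} (hg0 : g ≠ 0) (hg : ¬ ∃ c : F, algebraMap F E c = g) :
    Module.finrank F ↥(W ⊓ W.comap (LinearMap.mulLeft F g)) = 1 := by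
  have : FiniteDimensional F E := Module.finite_of_finrank_pos (by omega)
  let e : E ≃ₗ[F] E := LinearEquiv.ofBijective (LinearMap.mulLeft F g)
    ⟨mul_right_injective₀ hg0, fun y ↦ ⟨y / g, mul_div_cancel₀ _ hg0⟩⟩
  have hcomap : Module.finrank F ↥(W.comap (LinearMap.mulLeft F g)) = 2 := by
    have : W.comap (LinearMap.mulLeft F g) = W.map (e.symm : E →ₗ[F] E) := by
      ext x
      rw [Submodule.mem_comap, Submodule.mem_map_equiv]
      rfl
    rw [this, LinearEquiv.finrank_map_eq, hW]
  have hsum := Submodule.finrank_sup_add_finrank_inf_eq W (W.comap (LinearMap.mulLeft F g))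
  have hsup := Submodule.finrank_le (W ⊔ W.comap (LinearMap.mulLeft F g))
  have hinf : Module.finrank F ↥(W ⊓ W.comap (LinearMap.mulLeft F g)) ≤ 2 :=
    hW ▸ Submodule.finrank_mono inf_le_left
  have hne : Module.finrank F ↥(W ⊓ W.comap (LinearMap.mulLeft F g)) ≠ 2 := by
    intro h
    have heq := Submodule.eq_of_le_of_finrank_eq
      (inf_le_left : W ⊓ W.comap (LinearMap.mulLeft F g) ≤ W) (h.trans hW.symm)
    exact hg (exists_algebraMap_eq_of_mul_mem hE hW fun x hx ↦ (heq.ge hx).2)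
  omega

omit [Finite F] in
theorem card_filter_mem_ne_zero [Fintype E] [DecidableEq E] (V : Submodule F E)
    [DecidablePred (· ∈ V)] :
    (Finset.univ.filter fun x : E ↦ x ∈ V ∧ x ≠ 0).card =
      Nat.card F ^ Module.finrank F V - 1 := by
  have : (Finset.univ.filter fun x : E ↦ x ∈ V ∧ x ≠ 0) =
      (Finset.univ.filter fun x : E ↦ x ∈ V).erase 0 := by
    ext x; simp [and_comm]
  rw [this, Finset.card_erase_of_mem (by simp), ← Module.natCard_eq_pow_finrank (K := F) (V := V),
    Nat.card_eq_fintype_card, Fintype.card_subtype]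

theorem exists_lt_pow_eq {α : Eˣ} (hα : IsPrimitive α) (hE : Module.finrank F E = 3)
    (hs : Nat.card F = s ^ 2) {x : E} (hx : x ≠ 0) :
    ∃ u < s ^ 2 + s + 1, x ^ ((s - 1) * (s ^ 3 + 1)) =
      ((α : E) ^ u) ^ ((s - 1) * (s ^ 3 + 1)) := by
  have : FiniteDimensional F E := Module.finite_of_finrank_pos (by omega)
  have : Finite E := Module.finite_of_finite F
  have h2 := two_le_of_card_eq_sq hs
  have hroot := hα.isPrimitiveRoot hE hs
  rw [pow_six_sub_one_eq h2] at hroot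
  obtain ⟨n, hn⟩ := (Submonoid.mem_powers_iff _ _).1
    (mem_powers_iff_mem_zpowers.2 (hα (Units.mk0 x hx)))
  have hn' : (α : E) ^ n = x := by
    rw [← Units.val_pow_eq_pow_val, hn, Units.val_mk0]
  refine ⟨n % (s ^ 2 + s + 1), Nat.mod_lt _ (by omega), ?_⟩
  rw [← hn']
  conv_lhs => rw [← Nat.mod_add_div n (s ^ 2 + s + 1)]
  rw [pow_add, mul_pow, ← pow_mul _ ((s ^ 2 + s + 1) * _), mul_right_comm, pow_mul _ (_ * _),
    hroot.pow_eq_one, one_pow, mul_one]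

theorem pow_pow_exp_injOn {α : Eˣ} (hα : IsPrimitive α) (hE : Module.finrank F E = 3)
    (hs : Nat.card F = s ^ 2) :
    Set.InjOn (fun u : ℕ ↦ ((α : E) ^ u) ^ ((s - 1) * (s ^ 3 + 1)))
      (Finset.range (s ^ 2 + s + 1) : Set ℕ) := by
  have h2 := two_le_of_card_eq_sq hs
  have hM := exp_pos_of_two_le h2
  have hroot := hα.isPrimitiveRoot hE hs
  rw [pow_six_sub_one_eq h2] at hroot
  intro u hu v hv huv
  rw [Finset.mem_coe, Finset.mem_range] at hu hv
  simp only [← pow_mul] at huv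
  exact Nat.eq_of_mul_eq_mul_right hM (hroot.pow_inj (Nat.mul_lt_mul_of_pos_right hu hM)
    (Nat.mul_lt_mul_of_pos_right hv hM) huv)

/-- The number of pairs of nonzero elements of a plane with equal `(s - 1) * (s ^ 3 + 1)`-th
powers. -/
theorem sum_card_filter_pow_eq [Fintype E] [DecidableEq E] {α : Eˣ} (hα : IsPrimitive α)
    (hE : Module.finrank F E = 3) (hs : Nat.card F = s ^ 2) {W : Submodule F E}
    [DecidablePred (· ∈ W)] (hW : Module.finrank F W = 2) (N : Finset E)
    (hN : N = Finset.univ.filter fun x : E ↦ x ∈ W ∧ x ≠ 0) :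
    ∑ x ∈ N, (N.filter fun y ↦ y ^ ((s - 1) * (s ^ 3 + 1)) = x ^ ((s - 1) * (s ^ 3 + 1))).card =
      (s ^ 2 - 1) * (s ^ 4 - 1) + (s ^ 2 - 1) * (s ^ 2 - s) * (s ^ 2 - 1) := by
  classical
  have : Fintype F := Fintype.ofFinite F
  have h2 := two_le_of_card_eq_sq hs
  have hM := exp_pos_of_two_le h2
  have hcardF : Fintype.card F = s ^ 2 := by rw [← hs, Nat.card_eq_fintype_card]
  let C : Finset E := Finset.univ.filter fun x : E ↦ x ^ ((s - 1) * (s ^ 3 + 1)) = 1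
  have hC : C.card = (s ^ 2 - 1) * (s ^ 2 - s + 1) := by
    have := card_filter_pow_eq hα hE hs (one_ne_zero (α := E))
    rw [one_pow] at this
    rw [← exp_eq_mul h2, ← this]
  have ne_zero_of_mem {g : E} (hg : g ∈ C) : g ≠ 0 := by
    rintro rfl
    rw [Finset.mem_filter, zero_pow hM.ne'] at hg
    exact zero_ne_one hg.2
  let K : Finset E := (Finset.univ.erase (0 : F)).image (algebraMap F E)
  have hK : K.card = s ^ 2 - 1 := by
    rw [Finset.card_image_of_injective _ (algebraMap F E).injective,
      Finset.card_erase_of_mem (Finset.mem_univ _), Finset.card_univ, hcardF]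
  have hKC : K ⊆ C := by
    intro g hg
    obtain ⟨c, hc, rfl⟩ := Finset.mem_image.1 hg
    exact Finset.mem_filter.2 ⟨Finset.mem_univ _, algebraMap_pow_eq_one hs (Finset.mem_erase.1 hc).1⟩
  have hinner (x : E) (hx : x ∈ N) :
      (N.filter fun y ↦ y ^ ((s - 1) * (s ^ 3 + 1)) = x ^ ((s - 1) * (s ^ 3 + 1))).card =
        (C.filter fun g ↦ g * x ∈ W).card := by
    rw [hN, Finset.mem_filter] at hx
    obtain ⟨-, hxW, hx0⟩ := hx
    symm
    rw [← Finset.card_image_of_injective _ (mul_left_injective₀ hx0)]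
    congr 1
    ext y
    simp only [C, hN, Finset.mem_image, Finset.mem_filter, Finset.mem_univ, true_and]
    constructor
    · rintro ⟨g, ⟨hg, hgW⟩, rfl⟩
      refine ⟨⟨hgW, mul_ne_zero ?_ hx0⟩, by rw [mul_pow, hg, one_mul]⟩
      exact ne_zero_of_mem (Finset.mem_filter.2 ⟨Finset.mem_univ _, hg⟩)
    · rintro ⟨⟨hyW, -⟩, hy⟩
      refine ⟨y / x, ⟨?_, ?_⟩, div_mul_cancel₀ _ hx0⟩
      · rw [div_pow, hy, div_self (pow_ne_zero _ hx0)]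
      · rwa [div_mul_cancel₀ _ hx0]
  -- Double counting: fix the ratio `g` of the pair rather than its first entry.
  have hswap : ∑ x ∈ N, (C.filter fun g ↦ g * x ∈ W).card =
      ∑ g ∈ C, (N.filter fun x ↦ g * x ∈ W).card := by
    simp only [Finset.card_filter]
    exact Finset.sum_comm
  rw [Finset.sum_congr rfl hinner, hswap, ← Finset.sum_sdiff hKC]
  have hin : ∀ g ∈ K, (N.filter fun x ↦ g * x ∈ W).card = s ^ 4 - 1 := by
    intro g hg
    obtain ⟨c, -, rfl⟩ := Finset.mem_image.1 hg
    rw [Finset.filter_true_of_mem, hN, card_filter_mem_ne_zero, hW, hs, ← pow_mul]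
    intro x hx
    rw [hN, Finset.mem_filter] at hx
    rw [← Algebra.smul_def]
    exact W.smul_mem c hx.2.1
  have hout : ∀ g ∈ C \ K, (N.filter fun x ↦ g * x ∈ W).card = s ^ 2 - 1 := by
    intro g hg
    rw [Finset.mem_sdiff] at hg
    have hg0 := ne_zero_of_mem hg.1
    have hgF : ¬ ∃ c : F, algebraMap F E c = g := by
      rintro ⟨c, rfl⟩
      refine hg.2 (Finset.mem_image.2 ⟨c, ?_, rfl⟩)
      rw [Finset.mem_erase]
      exact ⟨by rintro rfl; exact hg0 (map_zero _), Finset.mem_univ _⟩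
    have := card_filter_mem_ne_zero (W ⊓ W.comap (LinearMap.mulLeft F g))
    rw [finrank_inf_comap_mulLeft hE hW hg0 hgF, hs, pow_one] at this
    rw [← this, hN, Finset.filter_filter]
    congr 1
    ext x
    simp only [Finset.mem_filter, Submodule.mem_inf, Submodule.mem_comap,
      LinearMap.mulLeft_apply]
    tauto
  rw [Finset.sum_congr rfl hin, Finset.sum_congr rfl hout, Finset.sum_const, Finset.sum_const,
    Finset.card_sdiff_of_subset hKC, hC, hK, smul_eq_mul, smul_eq_mul, mul_add_one,
    Nat.add_sub_cancel, add_comm]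

theorem w_le_two {α : Eˣ} (hα : IsPrimitive α) (hE : Module.finrank F E = 3)
    (hs : Nat.card F = s ^ 2) {ℓ : Set (ℙ F E)} (hℓ : IsLine F ℓ) (u : ℕ) :
    w F α (s ^ 2 - s + 1) ℓ u ≤ 2 := by
  have : FiniteDimensional F E := Module.finite_of_finrank_pos (by omega)
  have : Finite E := Module.finite_of_finite F
  by_contra! h
  obtain ⟨P, Q, R, hP, hQ, hR, hPQ, hPR, hQR⟩ := (Set.two_lt_ncard_iff (Set.toFinite _)).1 h
  exact (isKestenbandEbertArc_singerOrbit hα hE hs u).1 P hP.2 Q hQ.2 R hR.2 hPQ hPR hQR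
    ⟨ℓ, hℓ, hP.1, hQ.1, hR.1⟩

theorem sum_w_and_sum_w_sq {α : Eˣ} (hα : IsPrimitive α) (hE : Module.finrank F E = 3)
    (hs : Nat.card F = s ^ 2) {ℓ : Set (ℙ F E)} (hℓ : IsLine F ℓ) :
    ∑ u ∈ Finset.range (s ^ 2 + s + 1), w F α (s ^ 2 - s + 1) ℓ u = s ^ 2 + 1 ∧
    ∑ u ∈ Finset.range (s ^ 2 + s + 1), w F α (s ^ 2 - s + 1) ℓ u ^ 2 =
      s ^ 2 + 1 + (s ^ 2 - s) := by
  classical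
  have : FiniteDimensional F E := Module.finite_of_finrank_pos (by omega)
  have : Finite E := Module.finite_of_finite F
  have : Fintype E := Fintype.ofFinite E
  have h2 := two_le_of_card_eq_sq hs
  obtain ⟨W, hW, rfl⟩ := hℓ
  obtain ⟨N, hN⟩ : ∃ N : Finset E, N = Finset.univ.filter fun x : E ↦ x ∈ W ∧ x ≠ 0 := ⟨_, rfl⟩
  have hNcard : N.card = s ^ 4 - 1 := by
    rw [hN, card_filter_mem_ne_zero, hW, hs, ← pow_mul]
  let β : ℕ → E := fun u ↦ ((α : E) ^ u) ^ ((s - 1) * (s ^ 3 + 1))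
  have hβ := pow_pow_exp_injOn hα hE hs
  have hmaps : ∀ x ∈ N, x ^ ((s - 1) * (s ^ 3 + 1)) ∈ (Finset.range (s ^ 2 + s + 1)).image β := by
    intro x hx
    rw [hN, Finset.mem_filter] at hx
    obtain ⟨u, hu, hxu⟩ := exists_lt_pow_eq hα hE hs hx.2.2
    exact Finset.mem_image.2 ⟨u, Finset.mem_range.2 hu, hxu.symm⟩
  have hfib (u : ℕ) : (N.filter fun x ↦ x ^ ((s - 1) * (s ^ 3 + 1)) = β u).card =
      (s ^ 2 - 1) * w F α (s ^ 2 - s + 1) {P : ℙ F E | P.submodule ≤ W} u := by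
    rw [← Set.ncard_coe_finset, ncard_eq_mul_ncard_setOf_rep_mem (F := F), hs, w,
      singerOrbit_eq hα hE hs]
    · congr 2
      ext P
      simp [hN, β, Projectivization.submodule_eq, Projectivization.rep_nonzero]
    · simp [hN]
    · intro c hc x hx
      simp only [hN, Finset.coe_filter, Finset.mem_filter, Finset.mem_univ, true_and,
        Set.mem_ofPred_eq] at hx ⊢
      exact ⟨⟨W.smul_mem c hx.1.1, smul_ne_zero hc hx.1.2⟩, (smul_pow_eq hs hc x).trans hx.2⟩
  have hpos : 0 < s ^ 2 - 1 := by
    have : 1 < s ^ 2 := by nlinarith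
    omega
  have h4 : s ^ 4 - 1 = (s ^ 2 - 1) * (s ^ 2 + 1) := by
    obtain ⟨n, hn⟩ : ∃ n, s ^ 2 = n + 1 := ⟨s ^ 2 - 1, by omega⟩
    rw [show s ^ 4 = (s ^ 2) ^ 2 by ring, hn, Nat.sub_eq_iff_eq_add (by nlinarith),
      Nat.add_sub_cancel]
    ring
  constructor
  · have h := Finset.card_eq_sum_card_fiberwise (f := fun x : E ↦ x ^ ((s - 1) * (s ^ 3 + 1)))
      hmaps
    rw [Finset.sum_image hβ, Finset.sum_congr rfl fun u _ ↦ hfib u, ← Finset.mul_sum, hNcard,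
      h4] at h
    exact (Nat.eq_of_mul_eq_mul_left hpos h).symm
  -- Grouping the pairs by their common `M`-th power, the class of `u` contributes the square of its
  -- size, `((q - 1) * w_u) ^ 2`.
  · have h := Finset.sum_fiberwise_of_maps_to hmaps fun x ↦
      (N.filter fun y ↦ y ^ ((s - 1) * (s ^ 3 + 1)) = x ^ ((s - 1) * (s ^ 3 + 1))).card
    rw [sum_card_filter_pow_eq hα hE hs hW N hN, Finset.sum_image hβ, h4] at h
    have hterm (u : ℕ) : ∑ x ∈ N.filter (fun x ↦ x ^ ((s - 1) * (s ^ 3 + 1)) = β u),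
        (N.filter fun y ↦ y ^ ((s - 1) * (s ^ 3 + 1)) = x ^ ((s - 1) * (s ^ 3 + 1))).card =
        (s ^ 2 - 1) ^ 2 * w F α (s ^ 2 - s + 1) {P : ℙ F E | P.submodule ≤ W} u ^ 2 := by
      rw [← mul_pow, ← hfib, sq]
      exact Finset.sum_const_nat fun x hx ↦ by rw [(Finset.mem_filter.1 hx).2]
    rw [Finset.sum_congr rfl fun u _ ↦ hterm u, ← Finset.mul_sum] at h
    refine Nat.eq_of_mul_eq_mul_left (pow_pos hpos 2) (h.trans ?_)
    ring

/-- A sequence of values at most `2` is determined up to order by its first two moments. -/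
theorem card_filter_of_sum_of_sum_sq (T : Finset ℕ) (f : ℕ → ℕ) (hf : ∀ u ∈ T, f u ≤ 2) :
    T.card = (T.filter fun u ↦ f u = 0).card + (T.filter fun u ↦ f u = 1).card +
      (T.filter fun u ↦ f u = 2).card ∧
    ∑ u ∈ T, f u = (T.filter fun u ↦ f u = 1).card + 2 * (T.filter fun u ↦ f u = 2).card ∧
    ∑ u ∈ T, f u ^ 2 = (T.filter fun u ↦ f u = 1).card + 4 * (T.filter fun u ↦ f u = 2).card := by
  rw [Finset.card_eq_sum_ones T]
  simp only [Finset.card_filter, Finset.mul_sum, ← Finset.sum_add_distrib]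
  refine ⟨Finset.sum_congr rfl fun u hu ↦ ?_, Finset.sum_congr rfl fun u hu ↦ ?_,
    Finset.sum_congr rfl fun u hu ↦ ?_⟩ <;>
  · have := hf u hu
    interval_cases f u <;> simp

end Counting
end SingerOrbits

open SingerOrbits in
theorem mainTheorem9 (F E : Type*) [Field F] [Finite F] [Field E] [Algebra F E]
    (hE : Module.finrank F E = 3)
    (α : Eˣ) (hα : IsPrimitive α)
    (ℓ₀ : Set (ℙ F E)) (hℓ₀ : IsLine F ℓ₀)
    (q s d t : ℕ) (hq : Nat.card F = q) (hs : q = s ^ 2)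
    (hd : d = q - s + 1) (ht : t = singerIndex F d) :
    d ∣ q ^ 2 + q + 1 ∧
    t = q + s + 1 ∧
    (∀ u < t, w F α d ℓ₀ u ≤ 2) ∧
    2 * ((Finset.range t).filter (fun u => w F α d ℓ₀ u = 0)).card = q + s ∧
    ((Finset.range t).filter (fun u => w F α d ℓ₀ u = 1)).card = s + 1 ∧
    2 * ((Finset.range t).filter (fun u => w F α d ℓ₀ u = 2)).card = q - s ∧
    (∀ u < t, (singerOrbit F α d u).ncard = d ∧ IsKestenbandEbertArc F (singerOrbit F α d u)) ∧
    (4 < q → ∀ u < t, IsCompleteArc F (singerOrbit F α d u)) := by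
  subst hs hd
  rw [singerIndex_eq hq] at ht
  subst ht
  have h2 := two_le_of_card_eq_sq hq
  have hss : s ≤ s ^ 2 := by nlinarith
  have hw (u : ℕ) := w_le_two hα hE hq hℓ₀ u
  obtain ⟨h₀, h₁, h₂⟩ := card_filter_of_sum_of_sum_sq (Finset.range (s ^ 2 + s + 1))
    (w F α (s ^ 2 - s + 1) ℓ₀) fun u _ ↦ hw u
  obtain ⟨hsum, hsq⟩ := sum_w_and_sum_w_sq hα hE hq hℓ₀
  rw [Finset.card_range] at h₀
  rw [hsum] at h₁
  rw [hsq] at h₂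
  refine ⟨⟨_, sq_add_eq_mul h2⟩, rfl, fun u _ ↦ hw u, by omega, by omega, by omega,
    fun u _ ↦ ⟨ncard_singerOrbit hα hE hq u, isKestenbandEbertArc_singerOrbit hα hE hq u⟩,
    fun h4 u _ ↦ isCompleteArc_singerOrbit hα hE hq ?_ u⟩
  by_contra! h3
  interval_cases s
  omega
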